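/- Let $N,B,W,T$ be integers with $1\le N\le B$, $B+1\le W$ and $T\ge B$, and put $T_{\mathrm{eff}}=\min(T,W-1)$. Let $\mathcal C(N,B,W)$ be the packet erasure channel in which, in every window of $W$ consecutive time slots, the erasures are either at most $N$ in arbitrary positions or form a single burst of consecutive slots of length at most $B$. A streaming code of rate $R=k/n$ and delay $T$ over a finite field $\mathbb F_q$ consists of causal encoders $\mathbf x[i]=f_i(\mathbf s[0],\dots,\mathbf s[i])\in\mathbb F_q^n$ for source symbols $\mathbf s[i]\in\mathbb F_q^k$, $i\ge 0$, and decoders $g_i$; it is feasible for the channel if $\mathbf s[i]=g_i(\mathbf y[0],\dots,\mathbf y[i+T])$ for all source sequences, all admissible erasure patterns and all $i\ge 0$, where $\mathbf y$ is the channel output. Matrices $\mathbf H_0,\dots,\mathbf H_m\in\mathbb F_q^{k'\times r'}$ define a systematic Strongly-MDS code of memory $m$ if, for every $j\le m$, every input with $\mathbf s[0]\ne 0$ to the encoder $\mathbf s[i]\mapsto(\mathbf s[i],\sum_{t=0}^{m}\mathbf s^\dagger[i-t]\mathbf H_t)$ produces at least $r'(j+1)+1$ non-zero sub-symbols in the time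 slots $0,\dots,j$ (symbols at negative times are zero). Then there exists, over some finite field $\mathbb F_q$, a streaming code of delay $T$ that is feasible for $\mathcal C(N,B,W)$ and whose rate $R\in(0,1)$ satisfies $$\Big(\frac{R}{1-R}\Big)B+N>T_{\mathrm{eff}}.$$ Moreover the code can be taken of the following layered form (a MiDAS code). Each source symbol is split as $\mathbf s[i]=(\mathbf u[i],\mathbf v[i])\in\mathbb F_q^{k^u}\times\mathbb F_q^{k^v}$, and the channel packet is $\mathbf x[i]=(\mathbf u[i],\mathbf v[i],\mathbf q[i],\mathbf p^u[i])\in\mathbb F_q^{2k^u+k^v+k^s}$ with $$\mathbf q[i]=\sum_{j=0}^{T_{\mathrm{eff}}}\mathbf v^\dagger[i-j]\mathbf H^v_j+\mathbf u^\dagger[i-T_{\mathrm{eff}}],\qquad \mathbf p^u[i]=\sum_{j=0}^{T_{\mathrm{eff}}}\mathbf u^\dagger[i-j]\mathbf H^u_j,$$ where both $(\mathbf H^v_j)$ and $(\mathbf H^u_j)$ define systematic Strongly-MDS codes of memory $T_{\mathrm{eff}}$. -/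

import Mathlib

namespace Streaming

/-- The sliding-window erasure channel `C(N, B, W)`, given by its set of admissible erasure
patterns: `E` is the set of time slots whose packet is erased. In every window of `W` consecutive
slots there are either at most `N` erasures (in arbitrary positions), or the erasures form a single
burst (a block of consecutive slots) of length at most `B`. -/
def channel (N B W : ℕ) : Set (Set ℕ) :=
  {E | ∀ i : ℕ, (E ∩ Set.Ico i (i + W)).ncard ≤ N ∨
    ∃ a L : ℕ, L ≤ B ∧ E ∩ Set.Ico i (i + W) = Set.Ico a (a + L)}

open Classical in
/-- The channel output stream for input stream `x` under erasure pattern `E`; `none` is the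
erasure symbol. -/
noncomputable def received {X : Type} (E : Set ℕ) (x : ℕ → X) : ℕ → Option X :=
  fun i => if i ∈ E then none else some (x i)

/-- A streaming code with delay `T` over the alphabet `F`. Source symbols lie in `F ^ κ`, channel
symbols in `F ^ ν`, for finite index types `κ`, `ν` (so `k = |κ|` and `n = |ν|`).
The encoder is causal: `x[i] = f_i(s[0], …, s[i])`.
The decoder has delay `T`: the estimate of `s[i]` is `g_i(y[0], …, y[i+T])`. -/
structure StreamingCode (F κ ν : Type) (T : ℕ) where
  /-- the map from source streams to channel input streams -/
  encode : (ℕ → κ → F) → ℕ → ν → F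
  encode_causal : ∀ (s s' : ℕ → κ → F) (i : ℕ),
    (∀ j ≤ i, s j = s' j) → encode s i = encode s' i
  /-- the map from channel output streams to source estimates -/
  decode : (ℕ → Option (ν → F)) → ℕ → κ → F
  decode_causal : ∀ (y y' : ℕ → Option (ν → F)) (i : ℕ),
    (∀ j ≤ i + T, y j = y' j) → decode y i = decode y' i

/-- The rate `R = k / n`. -/
noncomputable def StreamingCode.rate {F κ ν : Type} {T : ℕ} [Fintype κ] [Fintype ν]
    (_C : StreamingCode F κ ν T) : ℝ :=
  (Fintype.card κ : ℝ) / (Fintype.card ν : ℝ)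

/-- The code is feasible for a channel (a set of erasure patterns): for every admissible erasure
pattern and every source stream, every source symbol is decoded correctly (hence, by
`decode_causal`, with delay `T`). -/
def StreamingCode.Feasible {F κ ν : Type} {T : ℕ} (C : StreamingCode F κ ν T)
    (chan : Set (Set ℕ)) : Prop :=
  ∀ E ∈ chan, ∀ (s : ℕ → κ → F) (i : ℕ), C.decode (received E (C.encode s)) i = s i

/-- The symbol `s[i - d]`, with the convention that symbols at negative times are zero. -/
def delayed {κ F : Type} [Zero F] (s : ℕ → κ → F) (i d : ℕ) : κ → F :=
  if d ≤ i then s (i - d) else 0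

/-- Parity-check symbols of a systematic convolutional code of memory `m`:
`p[i] = ∑_{t = 0}^{m} s[i - t] · H_t`. -/
def parity {κ ρ F : Type} [Fintype κ] [Field F] (m : ℕ) (H : ℕ → Matrix κ ρ F)
    (s : ℕ → κ → F) (i : ℕ) : ρ → F :=
  ∑ t ∈ Finset.range (m + 1), Matrix.vecMul (delayed s i t) (H t)

/-- The systematic convolutional encoder `x[i] = (s[i], p[i])`. -/
def systematic {κ ρ F : Type} [Fintype κ] [Field F] (m : ℕ) (H : ℕ → Matrix κ ρ F)
    (s : ℕ → κ → F) (i : ℕ) : κ ⊕ ρ → F :=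
  Sum.elim (s i) (parity m H s i)

open Classical in
/-- The `j`-th column distance (at sub-symbol level) of the systematic convolutional code with
parity matrices `H_0, …, H_m`: the minimum of the number of non-zero sub-symbols in
`x[0], …, x[j]` over all inputs with `s[0] ≠ 0`. (It is `⊤` if there is no such input, i.e. if
`κ` is empty.) -/
noncomputable def columnDistance {κ ρ F : Type} [Fintype κ] [Fintype ρ] [Field F] (m : ℕ)
    (H : ℕ → Matrix κ ρ F) (j : ℕ) : ℕ∞ :=
  ⨅ (s : ℕ → κ → F) (_ : s 0 ≠ 0),
    ((∑ i ∈ Finset.range (j + 1), hammingNorm (systematic m H s i) : ℕ) : ℕ∞)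

/-- `H_0, …, H_m` define a systematic `(k + r, k, m)` Strongly-MDS code, `k = |κ|`, `r = |ρ|`: for
each `j ≤ m` the `j`-th column distance attains the general upper bound `r * (j + 1) + 1`
(which never is exceeded when `k ≥ 1`; for `k = 0` the condition is void). -/
def IsStronglyMDS {κ ρ F : Type} [Fintype κ] [Fintype ρ] [Field F] (m : ℕ)
    (H : ℕ → Matrix κ ρ F) : Prop :=
  ∀ j ≤ m, ((Fintype.card ρ * (j + 1) + 1 : ℕ) : ℕ∞) ≤ columnDistance m H j

/-- The `u`-part of a source stream `s[i] = (u[i], v[i])`. -/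
def uPart {μ η F : Type} (s : ℕ → μ ⊕ η → F) : ℕ → μ → F := fun i a => s i (Sum.inl a)

/-- The `v`-part of a source stream `s[i] = (u[i], v[i])`. -/
def vPart {μ η F : Type} (s : ℕ → μ ⊕ η → F) : ℕ → η → F := fun i a => s i (Sum.inr a)

/-- The generalized Maximally Short encoder with shift `τ`: `x[i] = (u[i], v[i], q[i])` where
`q[i] = p^v[i] + u[i - τ]` and `p^v[i] = ∑_{t = 0}^{τ} v[i - t] · Hv_t`. -/
def gmsEncode {μ η F : Type} [Fintype η] [Field F] (τ : ℕ) (Hv : ℕ → Matrix η μ F)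
    (s : ℕ → μ ⊕ η → F) (i : ℕ) : (μ ⊕ η) ⊕ μ → F :=
  Sum.elim (s i) (parity τ Hv (vPart s) i + delayed (uPart s) i τ)

/-- The MiDAS encoder with shift `τ`: the generalized Maximally Short packet with a further layer
of parity checks on the `u`-symbols, `x[i] = (u[i], v[i], q[i], p^u[i])`, where
`p^u[i] = ∑_{t = 0}^{τ} u[i - t] · Hu_t`. -/
def midasEncode {μ η σ F : Type} [Fintype μ] [Fintype η] [Field F] (τ : ℕ)
    (Hv : ℕ → Matrix η μ F) (Hu : ℕ → Matrix μ σ F)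
    (s : ℕ → μ ⊕ η → F) (i : ℕ) : ((μ ⊕ η) ⊕ μ) ⊕ σ → F :=
  Sum.elim (gmsEncode τ Hv s i) (parity τ Hu (uPart s) i)

end Streaming

/-! Write τ for `min T (W - 1)`. A window starting at an erased slot i contains slots i, …, i+τ, and
these all lie within the decoding deadline. By linearity, it suffices that an input vanishing before
i, whose packets vanish on the unerased slots, also vanishes at i.

If at most N slots are erased, the p^u layer forces u[i] = 0. The shifted u-symbols in q up to time
i+τ then vanish, so q reduces to the parity of v and forces v[i] = 0. If the erasures form a burst,
it starts at i. Up to time i+τ-1 the u-symbols in q precede i, so the v-code alone clears all of v,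
and then q[i+τ] exposes u[i]. Both cases count weights: a non-zero Strongly-MDS codeword is too
heavy for the erased slots (`IsStronglyMDS.lt_card_mul`). The sizes needed are N(ku+ks) ≤ ks(τ+1)
and B(kv+ku) ≤ kuτ. Equality in both gives a rate with excess N/(τ+1).

Strongly-MDS matrices come from a block Toeplitz matrix with entries x^((J+M-I)^2). Its non-trivial
minors are non-zero polynomials in x, by the rearrangement inequality, so a large finite field
contains an x at which none vanishes. -/

namespace Streaming

open Polynomial

/-! ### Minors of block triangular Toeplitz matrices -/

/-- The entry in row `I` and column `J` of the block upper triangular Toeplitz matrix with blocks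
of size `M` and entries `x ^ (J + M - I) ^ 2`. -/
def toeplitzEntry {R : Type} [CommRing R] (x : R) (M I J : ℕ) : R :=
  if I / M ≤ J / M then x ^ ((J + M - I) ^ 2) else 0

/-- The shift by M in the exponent prevents truncated subtraction wherever the block condition
holds. -/
theorem lt_add_of_div_le_div {M I J : ℕ} (hM : 0 < M) (h : I / M ≤ J / M) : I < J + M := by
  have h1 := Nat.div_add_mod I M
  have h2 := Nat.div_add_mod J M
  have h3 := Nat.mod_lt I hM
  have h4 := Nat.mul_le_mul_left M h
  omega

/-- Among all pairings of two increasing sequences, the monotone one is the unique minimizer of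
the sum of squared differences. -/
theorem sum_sq_sub_lt_of_ne_one {w : ℕ} {f g : Fin w → ℤ} (hf : StrictMono f) (hg : StrictMono g)
    {σ : Equiv.Perm (Fin w)} (hσ : σ ≠ 1) :
    ∑ l, (g l - f l) ^ 2 < ∑ l, (g l - f (σ l)) ^ 2 := by
  have hmono : Monovary f g := fun a b hab => hf.monotone (hg.lt_iff_lt.1 hab).le
  have hlt : ∑ l, f (σ l) * g l < ∑ l, f l * g l := by
    -- Equality in the rearrangement inequality would make σ monotone, and the only monotone
    -- permutation is the identity.
    refine hmono.sum_comp_perm_mul_lt_sum_mul_iff.2 fun h => hσ ?_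
    have hm : Monotone σ := by
      intro a b hab
      rcases hab.eq_or_lt with rfl | hab
      · exact le_rfl
      · exact hf.le_iff_le.1 (h (hg hab))
    have hs : StrictMono σ := hm.strictMono_of_injective σ.injective
    ext l
    have := congrArg (fun e : Fin w ≃o Fin w => e l)
      (Subsingleton.elim (hs.orderIsoOfSurjective σ σ.surjective) (OrderIso.refl _))
    simpa using congrArg Fin.val this
  have hsq : ∑ l, f (σ l) ^ 2 = ∑ l, f l ^ 2 := Equiv.sum_comp σ fun l => f l ^ 2
  have h1 : ∑ l, (g l - f (σ l)) ^ 2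
      = ∑ l, g l ^ 2 + ∑ l, f (σ l) ^ 2 - 2 * ∑ l, f (σ l) * g l := by
    rw [Finset.mul_sum, ← Finset.sum_add_distrib, ← Finset.sum_sub_distrib]
    exact Finset.sum_congr rfl fun _ _ => by ring
  have h2 : ∑ l, (g l - f l) ^ 2 = ∑ l, g l ^ 2 + ∑ l, f l ^ 2 - 2 * ∑ l, f l * g l := by
    rw [Finset.mul_sum, ← Finset.sum_add_distrib, ← Finset.sum_sub_distrib]
    exact Finset.sum_congr rfl fun _ _ => by ring
  rw [h1, h2, hsq]
  linarith

/-- In the Leibniz expansion the identity contributes the monomial of strictly smallest degree;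
every other permutation meets a zero entry or has larger degree. Hence one coefficient equals 1. -/
theorem det_toeplitzEntry_X_ne_zero {R : Type} [CommRing R] [Nontrivial R] {M w : ℕ} (hM : 0 < M)
    {I J : Fin w → ℕ} (hI : StrictMono I) (hJ : StrictMono J) (hIJ : ∀ l, I l / M ≤ J l / M) :
    (Matrix.of fun a b => toeplitzEntry (X : R[X]) M (I a) (J b)).det ≠ 0 := by
  have hne : ((Matrix.of fun a b => toeplitzEntry (X : R[X]) M (I a) (J b)).det).coeff
      (∑ l, (J l + M - I l) ^ 2) = 1 := by
    rw [Matrix.det_apply, finsetSum_coeff, Finset.sum_eq_single 1]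
    · have : ∏ l, toeplitzEntry (X : R[X]) M (I l) (J l) = X ^ ∑ l, (J l + M - I l) ^ 2 := by
        rw [← Finset.prod_pow_eq_pow_sum]
        exact Finset.prod_congr rfl fun l _ => if_pos (hIJ l)
      simp [this]
    · intro σ _ hσ
      by_cases h : ∀ l, I (σ l) / M ≤ J l / M
      · have : ∏ l, toeplitzEntry (X : R[X]) M (I (σ l)) (J l)
            = X ^ ∑ l, (J l + M - I (σ l)) ^ 2 := by
          rw [← Finset.prod_pow_eq_pow_sum]
          exact Finset.prod_congr rfl fun l _ => if_pos (h l)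
        simp only [Matrix.of_apply, this, coeff_smul, coeff_X_pow]
        rw [if_neg, smul_zero]
        have hlt := sum_sq_sub_lt_of_ne_one (f := fun l => (I l : ℤ)) (g := fun l => (J l + M : ℤ))
          (fun a b hab => Nat.cast_lt.2 (hI hab))
          (fun a b hab => by have := hJ hab; simp only; omega) hσ
        have cast_sub : ∀ τ : Equiv.Perm (Fin w), (∀ l, I (τ l) / M ≤ J l / M) →
            ((∑ l, (J l + M - I (τ l)) ^ 2 : ℕ) : ℤ) = ∑ l, ((J l + M : ℤ) - I (τ l)) ^ 2 := by
          intro τ hτ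
          push_cast
          refine Finset.sum_congr rfl fun l _ => ?_
          rw [Nat.cast_sub (lt_add_of_div_le_div hM (hτ l)).le]
          push_cast
          rfl
        have h1 := cast_sub σ h
        have h2 := cast_sub 1 (by simpa using hIJ)
        simp only [Equiv.Perm.coe_one, id_eq] at h2
        intro heq
        rw [heq] at h2
        omega
      · push Not at h
        obtain ⟨l, hl⟩ := h
        have : ∏ l, toeplitzEntry (X : R[X]) M (I (σ l)) (J l) = 0 :=
          Finset.prod_eq_zero (Finset.mem_univ l) (if_neg (by omega))
        simp [this]
    · simp
  intro h
  rw [h] at hne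
  simp at hne

/-- The product of the polynomials has fewer roots than a field of 2^(deg+1) elements. -/
theorem exists_finite_field_aeval_ne_zero {ι : Type} [Finite ι] (p : ι → (ZMod 2)[X])
    (hp : ∀ i, p i ≠ 0) :
    ∃ (F : Type) (_ : Field F) (_ : Finite F) (_ : Algebra (ZMod 2) F) (x : F),
      ∀ i, aeval x (p i) ≠ 0 := by
  classical
  have := Fintype.ofFinite ι
  let P := ∏ i, p i
  have hP0 : P ≠ 0 := Finset.prod_ne_zero_iff.2 fun i _ => hp i
  have : Fact (Nat.Prime 2) := ⟨Nat.prime_two⟩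
  let F := GaloisField 2 (P.natDegree + 1)
  have : Fintype F := Fintype.ofFinite F
  have hmap : P.map (algebraMap (ZMod 2) F) ≠ 0 := by
    rwa [Ne, Polynomial.map_eq_zero]
  have hcard : (P.map (algebraMap (ZMod 2) F)).roots.toFinset.card < Fintype.card F := by
    have h1 : Nat.card F = 2 ^ (P.natDegree + 1) := GaloisField.card 2 _ (by omega)
    rw [← Nat.card_eq_fintype_card, h1]
    calc _ ≤ (P.map (algebraMap (ZMod 2) F)).roots.card := Multiset.toFinset_card_le _
      _ ≤ (P.map (algebraMap (ZMod 2) F)).natDegree := card_roots' _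
      _ ≤ P.natDegree := natDegree_map_le
      _ < P.natDegree + 1 := by omega
      _ < _ := Nat.lt_two_pow_self
  obtain ⟨x, hx⟩ := Finset.exists_mem_notMem_of_card_lt_card
    (s := (P.map (algebraMap (ZMod 2) F)).roots.toFinset) (t := Finset.univ) (by simpa using hcard)
  refine ⟨F, inferInstance, inferInstance, inferInstance, x, fun i hi => hx.2 ?_⟩
  rw [Multiset.mem_toFinset, mem_roots hmap, IsRoot.def, eval_map_algebraMap]
  refine Eq.trans (map_prod _ _ _) ?_
  exact Finset.prod_eq_zero (Finset.mem_univ i) hi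

/-- Over a suitable finite field, all minors of a block triangular Toeplitz matrix that do not
vanish for trivial reasons are non-zero. -/
theorem exists_det_toeplitzEntry_ne_zero (M L : ℕ) (hM : 0 < M) :
    ∃ (F : Type) (_ : Field F) (_ : Finite F) (x : F),
      ∀ (w : ℕ) (I J : Fin w → ℕ), StrictMono I → StrictMono J → (∀ l, I l < L) →
        (∀ l, J l < L) → (∀ l, I l / M ≤ J l / M) →
        (Matrix.of fun a b => toeplitzEntry x M (I a) (J b)).det ≠ 0 := by
  let ι := {q : Σ w : Fin (L + 1), (Fin w → Fin L) × (Fin w → Fin L) //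
    StrictMono q.2.1 ∧ StrictMono q.2.2 ∧ ∀ l, (q.2.1 l : ℕ) / M ≤ (q.2.2 l : ℕ) / M}
  obtain ⟨F, hF, hfin, halg, x, hx⟩ := exists_finite_field_aeval_ne_zero (ι := ι)
    (fun q => (Matrix.of fun a b =>
      toeplitzEntry (X : (ZMod 2)[X]) M (q.1.2.1 a) (q.1.2.2 b)).det)
    (fun q => det_toeplitzEntry_X_ne_zero hM (I := fun l => (q.1.2.1 l : ℕ))
      (J := fun l => (q.1.2.2 l : ℕ)) (fun _ _ h => q.2.1 h) (fun _ _ h => q.2.2.1 h) q.2.2.2)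
  refine ⟨F, hF, hfin, x, fun w I J hI hJ hIL hJL hIJ => ?_⟩
  -- The bound on the minor's size leaves only finitely many polynomials to avoid.
  have hw : w ≤ L := by
    simpa using Fintype.card_le_of_injective (fun l : Fin w => (⟨I l, hIL l⟩ : Fin L))
      (fun a b h => hI.injective (by simpa using h))
  have h := hx ⟨⟨⟨w, by omega⟩, fun l => ⟨I l, hIL l⟩, fun l => ⟨J l, hJL l⟩⟩,
    fun _ _ h => hI h, fun _ _ h => hJ h, hIJ⟩
  rw [AlgHom.map_det] at h
  convert h using 2
  ext a b
  simp only [AlgHom.mapMatrix_apply, Matrix.map_apply, Matrix.of_apply, toeplitzEntry]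
  split_ifs <;> simp
end Streaming

/-! ### Strongly-MDS codes from the Toeplitz matrix -/

namespace Streaming

/-- Serialization of a stream of vectors of length `k`, every time slot being padded with zeros to
length `M`. -/
def flat {A : Type} [Zero A] (M : ℕ) {k : ℕ} (f : ℕ → Fin k → A) (I : ℕ) : A :=
  if h : I % M < k then f (I / M) ⟨I % M, h⟩ else 0

theorem sum_range_flat {A : Type} [AddCommMonoid A] {M k : ℕ} (hM : 0 < M) (hk : k ≤ M)
    (f : ℕ → Fin k → A) (n : ℕ) :
    ∑ I ∈ Finset.range (M * n), flat M f I = ∑ i ∈ Finset.range n, ∑ a, f i a := by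
  induction n with
  | zero => simp
  | succ n ih =>
    rw [Nat.mul_succ, Finset.sum_range_add, ih, Finset.sum_range_succ]
    congr 1
    have h1 : ∀ y ∈ Finset.range M,
        flat M f (M * n + y) = if h : y < k then f n ⟨y, h⟩ else 0 := by
      intro y hy
      have hy := Finset.mem_range.1 hy
      have e1 : (M * n + y) / M = n := by
        rw [Nat.mul_add_div hM, Nat.div_eq_of_lt hy, add_zero]
      have e2 : (M * n + y) % M = y := by rw [Nat.mul_add_mod, Nat.mod_eq_of_lt hy]
      simp only [flat, e1, e2]
    rw [Finset.sum_congr rfl h1, ← Finset.sum_subset (Finset.range_mono hk)]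
    · rw [Finset.sum_range]
      exact Finset.sum_congr rfl fun a _ => dif_pos a.2
    · intro y _ hy
      exact dif_neg (by simpa using hy)

theorem toeplitzEntry_block {R : Type} [CommRing R] (x : R) {M i i' a b : ℕ} (ha : a < M)
    (hb : b < M) : toeplitzEntry x M (M * i' + a) (M * i + b)
      = if i' ≤ i then x ^ ((M * (i - i') + M + b - a) ^ 2) else 0 := by
  have hM : 0 < M := by omega
  have e1 : (M * i' + a) / M = i' := by rw [Nat.mul_add_div hM, Nat.div_eq_of_lt ha, add_zero]
  have e2 : (M * i + b) / M = i := by rw [Nat.mul_add_div hM, Nat.div_eq_of_lt hb, add_zero]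
  simp only [toeplitzEntry, e1, e2]
  split_ifs with h
  · congr 2
    obtain ⟨d, rfl⟩ := Nat.exists_eq_add_of_le h
    rw [Nat.add_sub_cancel_left, mul_add]
    omega
  · rfl

/-- The parity matrices cut out of the block triangular Toeplitz matrix. -/
def toeplitzParity {F : Type} [Field F] (x : F) (M k r : ℕ) (t : ℕ) : Matrix (Fin k) (Fin r) F :=
  Matrix.of fun a b => x ^ ((M * t + M + b - a) ^ 2)

theorem parity_toeplitzParity {F : Type} [Field F] (x : F) {M k r m i : ℕ} (hk : k ≤ M)
    (hr : r ≤ M) (hi : i ≤ m) (s : ℕ → Fin k → F) (b : Fin r) :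
    parity m (toeplitzParity x M k r) s i b
      = ∑ I ∈ Finset.range (M * (m + 1)), flat M s I * toeplitzEntry x M I (M * i + b) := by
  have hbM : (b : ℕ) < M := b.2.trans_le hr
  have h1 : ∀ I, flat M s I * toeplitzEntry x M I (M * i + b)
      = flat M (fun i' a => s i' a * toeplitzEntry x M (M * i' + a) (M * i + b)) I := by
    intro I
    simp only [flat]
    split_ifs with h
    · simp only [Nat.div_add_mod]
    · rw [zero_mul]
  simp only [h1]
  rw [sum_range_flat (by omega) hk, parity, Finset.sum_apply]
  rw [← Finset.sum_subset (Finset.range_mono (show i + 1 ≤ m + 1 by omega)),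
    ← Finset.sum_subset (Finset.range_mono (show i + 1 ≤ m + 1 by omega)),
    ← Finset.sum_range_reflect]
  · refine Finset.sum_congr rfl fun t ht => ?_
    have ht := Finset.mem_range.1 ht
    rw [Matrix.vecMul, dotProduct]
    refine Finset.sum_congr rfl fun a _ => ?_
    rw [toeplitzEntry_block x (a.2.trans_le hk) hbM, if_pos (by omega), delayed,
      if_pos (by omega), toeplitzParity, Matrix.of_apply]
    rw [show i - (i + 1 - 1 - t) = t by omega, show i + 1 - 1 - t = i - t by omega]
  · intro t _ ht
    refine Finset.sum_eq_zero fun a _ => ?_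
    rw [toeplitzEntry_block x (a.2.trans_le hk) hbM, if_neg (by simp at ht; omega), mul_zero]
  · intro t _ ht
    rw [delayed, if_neg (by simp at ht; omega), Matrix.zero_vecMul, Pi.zero_apply]

/-- If the non-trivial minors of the block triangular Toeplitz matrix do not vanish, an input
which is non-zero in the first block has, up to every time, more non-zero entries than the output
has zeros. -/
theorem card_zeros_lt_card_nonzeros {F : Type} [Field F] [DecidableEq F] {x : F} {M m : ℕ}
    (hx : ∀ (w : ℕ) (I J : Fin w → ℕ), StrictMono I → StrictMono J →
      (∀ l, I l < M * (m + 1)) → (∀ l, J l < M * (m + 1)) → (∀ l, I l / M ≤ J l / M) →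
      (Matrix.of fun a b => toeplitzEntry x M (I a) (J b)).det ≠ 0)
    (s : ℕ → F) (hs : ∃ I < M, s I ≠ 0) (Q : ℕ → Prop) [DecidablePred Q] (j : ℕ) (hj : j ≤ m) :
    ((Finset.range (M * (j + 1))).filter fun J => Q J ∧
      ∑ I ∈ Finset.range (M * (m + 1)), s I * toeplitzEntry x M I J = 0).card <
    ((Finset.range (M * (j + 1))).filter fun I => s I ≠ 0).card := by
  obtain ⟨I₀, hI₀, hsI₀⟩ := hs
  have hM : 0 < M := by omega
  induction j using Nat.strong_induction_on with
  | _ j ih =>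
  set Z : ℕ → Finset ℕ := fun t => (Finset.range (M * (t + 1))).filter fun J => Q J ∧
      ∑ I ∈ Finset.range (M * (m + 1)), s I * toeplitzEntry x M I J = 0 with hZ
  set R : ℕ → Finset ℕ := fun t => (Finset.range (M * (t + 1))).filter fun I => s I ≠ 0 with hR
  change ∀ t < j, t ≤ m → (Z t).card < (R t).card at ih
  change (Z j).card < (R j).card
  by_contra! hcard
  have hjm : M * (j + 1) ≤ M * (m + 1) := Nat.mul_le_mul_left M (by omega)
  have lt_iff : ∀ a t, a < M * (t + 1) ↔ a / M ≤ t := by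
    intro a t
    rw [← Nat.lt_succ_iff, Nat.div_lt_iff_lt_mul hM, mul_comm]
  -- Rows: the whole support of `s`. Columns: the same number of zeros of the output, the earliest
  -- ones.
  let I : Fin (R j).card → ℕ := (R j).orderEmbOfFin rfl
  let J : Fin (R j).card → ℕ := (Z j).orderEmbOfFin rfl ∘ Fin.castLE hcard
  have hI : StrictMono I := ((R j).orderEmbOfFin rfl).strictMono
  have hJ : StrictMono J := ((Z j).orderEmbOfFin rfl).strictMono.comp (Fin.strictMono_castLE hcard)
  have hIR : ∀ l, I l ∈ R j := fun l => (R j).orderEmbOfFin_mem rfl l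
  have hJZ : ∀ l, J l ∈ Z j := fun l => (Z j).orderEmbOfFin_mem rfl _
  have hIj : ∀ l, I l < M * (j + 1) := fun l => by
    have := hIR l
    simp only [hR, Finset.mem_filter, Finset.mem_range] at this
    exact this.1
  have hJj : ∀ l, J l < M * (j + 1) := fun l => by
    have := hJZ l
    simp only [hZ, Finset.mem_filter, Finset.mem_range] at this
    exact this.1
  have hIJ : ∀ l, I l / M ≤ J l / M := by
    intro l
    -- With t the block of `J l`, block t and earlier would hold at least l+1 zeros but at most l
    -- support points, against the induction hypothesis at t.
    by_contra! hlt
    have hIl := (lt_iff _ _).1 (hIj l)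
    have h1 := ih (J l / M) (by omega) (by omega)
    have h2 : (l : ℕ) + 1 ≤ (Z (J l / M)).card := by
      have : (Finset.Iic l).image J ⊆ Z (J l / M) := by
        intro c hc
        simp only [Finset.mem_image, Finset.mem_Iic] at hc
        obtain ⟨l', hl', rfl⟩ := hc
        have h := hJZ l'
        simp only [hZ, Finset.mem_filter, Finset.mem_range] at h ⊢
        exact ⟨(lt_iff _ _).2 (Nat.div_le_div_right (hJ.monotone hl')), h.2⟩
      have h := Finset.card_le_card this
      rw [Finset.card_image_of_injective _ hJ.injective, Fin.card_Iic] at h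
      exact h
    have h3 : (R (J l / M)).card ≤ (l : ℕ) := by
      have : R (J l / M) ⊆ (Finset.Iio l).image I := by
        intro c hc
        have hc' : c ∈ R j := by
          simp only [hR, Finset.mem_filter, Finset.mem_range] at hc ⊢
          exact ⟨hc.1.trans_le (Nat.mul_le_mul_left M (by omega)), hc.2⟩
        have hmem : c ∈ Set.range ((R j).orderEmbOfFin rfl) := by
          rw [Finset.range_orderEmbOfFin]
          exact hc'
        obtain ⟨l', rfl⟩ := hmem
        refine Finset.mem_image.2 ⟨l', ?_, rfl⟩
        rw [Finset.mem_Iio]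
        by_contra! hle
        have h4 := Nat.div_le_div_right (c := M) (hI.monotone hle)
        have h5 : I l' / M ≤ J l / M := by
          refine (lt_iff _ _).1 ?_
          simp only [hR, Finset.mem_filter, Finset.mem_range] at hc
          exact hc.1
        omega
      have h := (Finset.card_le_card this).trans Finset.card_image_le
      rwa [Fin.card_Iio] at h
    omega
  have hdet := hx _ I J hI hJ (fun l => (hIj l).trans_le hjm) (fun l => (hJj l).trans_le hjm) hIJ
  have hzero : Matrix.vecMul (fun l => s (I l))
      (Matrix.of fun a b => toeplitzEntry x M (I a) (J b)) = 0 := by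
    ext l
    have h := hJZ l
    simp only [hZ, Finset.mem_filter, Finset.mem_range] at h
    rw [Pi.zero_apply, ← h.2.2]
    simp only [Matrix.vecMul, dotProduct, Matrix.of_apply]
    have himg : Finset.univ.image I = R j := by
      apply Finset.coe_injective
      rw [Finset.coe_image, Finset.coe_univ, Set.image_univ]
      exact Finset.range_orderEmbOfFin _ _
    rw [← Finset.sum_image (f := fun a => s a * toeplitzEntry x M a (J l)) hI.injective.injOn, himg]
    refine Finset.sum_subset (fun a ha => ?_) fun a _ ha => ?_
    · simp only [hR, Finset.mem_filter, Finset.mem_range] at ha ⊢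
      omega
    · simp only [hR, Finset.mem_filter, Finset.mem_range, not_and_or, not_not] at ha
      rcases ha with ha | ha
      · rw [toeplitzEntry, if_neg, mul_zero]
        have h1 := (lt_iff _ _).1 (hJj l)
        have h2 := (lt_iff a j).not.1 ha
        omega
      · rw [ha, zero_mul]
  have hv := Matrix.eq_zero_of_vecMul_eq_zero hdet hzero
  have hpos : 0 < (R j).card := by
    refine Finset.card_pos.2 ⟨I₀, ?_⟩
    simp only [hR, Finset.mem_filter, Finset.mem_range]
    exact ⟨hI₀.trans_le (Nat.le_mul_of_pos_right M (by omega)), hsI₀⟩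
  have h0 := congrFun hv ⟨0, hpos⟩
  have h1 := hIR ⟨0, hpos⟩
  simp only [hR, Finset.mem_filter] at h1
  exact h1.2 h0

theorem hammingNorm_systematic {F κ ρ : Type} [Fintype κ] [Fintype ρ] [Field F] [DecidableEq F]
    (m : ℕ) (H : ℕ → Matrix κ ρ F) (s : ℕ → κ → F) (i : ℕ) :
    hammingNorm (systematic m H s i) = hammingNorm (s i) + hammingNorm (parity m H s i) := by
  rw [hammingNorm, Finset.card_filter, Fintype.sum_sum_type]
  simp only [hammingNorm, Finset.card_filter, systematic, Sum.elim_inl, Sum.elim_inr]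
  congr!

/-- Zeros and non-zeros of the parity total r(j+1); since the input has more non-zeros than the
parity has zeros, the weight exceeds r(j+1). -/
theorem isStronglyMDS_toeplitzParity {F : Type} [Field F] {x : F} {M m : ℕ}
    (hx : ∀ (w : ℕ) (I J : Fin w → ℕ), StrictMono I → StrictMono J →
      (∀ l, I l < M * (m + 1)) → (∀ l, J l < M * (m + 1)) → (∀ l, I l / M ≤ J l / M) →
      (Matrix.of fun a b => toeplitzEntry x M (I a) (J b)).det ≠ 0)
    (k r : ℕ) (hk : k ≤ M) (hr : r ≤ M) : IsStronglyMDS m (toeplitzParity x M k r) := by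
  classical
  intro j hj
  rw [columnDistance]
  refine le_iInf fun s => le_iInf fun hs => ?_
  obtain ⟨a, ha⟩ := Function.ne_iff.1 hs
  have haM : (a : ℕ) < M := a.2.trans_le hk
  have hM : 0 < M := by omega
  -- The predicate discards the padding columns, which are not parity symbols.
  have h := card_zeros_lt_card_nonzeros hx (flat M s) ⟨a, haM, by
    simpa [flat, Nat.mod_eq_of_lt haM, Nat.div_eq_of_lt haM] using ha⟩ (fun J => J % M < r) j hj
  have h1 : ((Finset.range (M * (j + 1))).filter fun I => flat M s I ≠ 0).card
      = ∑ i ∈ Finset.range (j + 1), hammingNorm (s i) := by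
    simp only [hammingNorm, Finset.card_filter]
    rw [← sum_range_flat hM hk]
    refine Finset.sum_congr rfl fun I _ => ?_
    simp only [flat]
    split_ifs <;> simp_all
  have h2 : ((Finset.range (M * (j + 1))).filter fun J => J % M < r ∧
      ∑ I ∈ Finset.range (M * (m + 1)), flat M s I * toeplitzEntry x M I J = 0).card
      + ∑ i ∈ Finset.range (j + 1), hammingNorm (parity m (toeplitzParity x M k r) s i)
      = r * (j + 1) := by
    have h3 : ((Finset.range (M * (j + 1))).filter fun J => J % M < r ∧
      ∑ I ∈ Finset.range (M * (m + 1)), flat M s I * toeplitzEntry x M I J = 0).card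
        = ∑ i ∈ Finset.range (j + 1), ∑ b : Fin r,
          if parity m (toeplitzParity x M k r) s i b = 0 then 1 else 0 := by
      rw [Finset.card_filter, ← sum_range_flat hM hr]
      refine Finset.sum_congr rfl fun J hJ => ?_
      have hJm : J / M ≤ m := by
        have := (Nat.div_lt_iff_lt_mul hM).2 (mul_comm M (j + 1) ▸ Finset.mem_range.1 hJ)
        omega
      by_cases hJr : J % M < r
      · rw [flat.eq_1 M fun i b => if parity m (toeplitzParity x M k r) s i b = 0 then 1 else 0,
          dif_pos hJr, parity_toeplitzParity x hk hr hJm]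
        simp only [Nat.div_add_mod, hJr, true_and]
      · simp [flat, hJr]
    rw [h3, ← Finset.sum_add_distrib, mul_comm, ← smul_eq_mul, ← Finset.card_range (j + 1),
      ← Finset.sum_const, Finset.card_range]
    refine Finset.sum_congr rfl fun i _ => ?_
    rw [hammingNorm, ← Finset.card_filter, Finset.card_filter_add_card_filter_not]
    simp
  have h4 : r * (j + 1) + 1 ≤ ∑ i ∈ Finset.range (j + 1),
      hammingNorm (systematic m (toeplitzParity x M k r) s i) := by
    simp only [hammingNorm_systematic, Finset.sum_add_distrib]
    omega
  rw [Fintype.card_fin]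
  refine le_trans (Nat.cast_le.2 h4) (le_of_eq ?_)
  congr!

end Streaming

/-! ### Linearity, weight bounds and existence of a decoder -/

namespace Streaming

section Linear

variable {F : Type} [Field F]

theorem delayed_sub {κ : Type} (s s' : ℕ → κ → F) (i d : ℕ) :
    delayed (s - s') i d = delayed s i d - delayed s' i d := by
  simp only [delayed]
  split_ifs <;> simp

theorem parity_sub {κ ρ : Type} [Fintype κ] (m : ℕ) (H : ℕ → Matrix κ ρ F) (s s' : ℕ → κ → F)
    (i : ℕ) : parity m H (s - s') i = parity m H s i - parity m H s' i := by
  simp only [parity, delayed_sub, Matrix.sub_vecMul, Finset.sum_sub_distrib]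

theorem delayed_congr {κ : Type} {s s' : ℕ → κ → F} {i : ℕ} (h : ∀ j ≤ i, s j = s' j) (d : ℕ) :
    delayed s i d = delayed s' i d := by
  simp only [delayed, h (i - d) (Nat.sub_le i d)]

theorem parity_congr {κ ρ : Type} [Fintype κ] (m : ℕ) (H : ℕ → Matrix κ ρ F) {s s' : ℕ → κ → F}
    {i : ℕ} (h : ∀ j ≤ i, s j = s' j) : parity m H s i = parity m H s' i := by
  simp only [parity, delayed_congr h]

theorem delayed_add_of_forall_lt {κ : Type} {s : ℕ → κ → F} {i : ℕ} (h : ∀ j < i, s j = 0)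
    (t d : ℕ) : delayed s (i + t) d = delayed (fun n => s (i + n)) t d := by
  simp only [delayed]
  split_ifs with h1 h2 h2
  · rw [Nat.add_sub_assoc h2]
  · exact h _ (by omega)
  · omega
  · rfl

theorem systematic_add_of_forall_lt {κ ρ : Type} [Fintype κ] (m : ℕ) (H : ℕ → Matrix κ ρ F)
    {s : ℕ → κ → F} {i : ℕ} (h : ∀ j < i, s j = 0) (t : ℕ) :
    systematic m H s (i + t) = systematic m H (fun n => s (i + n)) t := by
  simp only [systematic, parity, delayed_add_of_forall_lt h]

theorem systematic_eq_zero {κ ρ : Type} [Fintype κ] {m : ℕ} {H : ℕ → Matrix κ ρ F}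
    {s : ℕ → κ → F} {i : ℕ} (h1 : s i = 0) (h2 : parity m H s i = 0) :
    systematic m H s i = 0 := by
  ext (a | a)
  · exact congrFun h1 a
  · exact congrFun h2 a

/-- A non-zero codeword of a Strongly-MDS code cannot be supported on few time slots. -/
theorem IsStronglyMDS.lt_card_mul {κ ρ : Type} [Fintype κ] [Fintype ρ] {m : ℕ}
    {H : ℕ → Matrix κ ρ F} (hH : IsStronglyMDS m H) {s : ℕ → κ → F} {i j : ℕ} (hj : j ≤ m)
    (hs : ∀ i' < i, s i' = 0) (hsi : s i ≠ 0) (S : Finset ℕ)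
    (hS : ∀ t ≤ j, i + t ∉ S → systematic m H s (i + t) = 0) :
    Fintype.card ρ * (j + 1) < S.card * (Fintype.card κ + Fintype.card ρ) := by
  classical
  have h := (hH j hj).trans (iInf₂_le (fun n => s (i + n)) hsi)
  have h := Nat.cast_le.1 h
  refine lt_of_lt_of_le (Nat.lt_of_succ_le h) ?_
  simp only [← systematic_add_of_forall_lt m H hs]
  have h1 : ∀ t ∈ Finset.range (j + 1), t ∉ (Finset.range (j + 1)).filter (fun t => i + t ∈ S) →
      hammingNorm (systematic m H s (i + t)) = 0 := by
    intro t ht htS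
    rw [hS t (by simpa [Nat.lt_succ_iff] using ht) (fun h => htS (Finset.mem_filter.2 ⟨ht, h⟩)),
      hammingNorm_zero]
  have h2 : ∑ t ∈ Finset.range (j + 1), hammingNorm (systematic m H s (i + t))
      ≤ S.card * (Fintype.card κ + Fintype.card ρ) := by
    rw [← Finset.sum_subset (Finset.filter_subset _ _) h1]
    refine (Finset.sum_le_card_nsmul _ _ (Fintype.card κ + Fintype.card ρ) fun t _ => ?_).trans ?_
    · rw [← Fintype.card_sum]
      exact hammingNorm_le_card_fintype
    · rw [smul_eq_mul]
      refine Nat.mul_le_mul_right _ (Finset.card_le_card_of_injOn (fun t => i + t) ?_ ?_)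
      · intro t ht
        exact (Finset.mem_filter.1 ht).2
      · intro a _ b _ hab
        simpa using hab
  convert h2

end Linear

theorem received_eq_none {X : Type} {E : Set ℕ} {x : ℕ → X} {i : ℕ} :
    received E x i = none ↔ i ∈ E := by
  simp [received]

open Classical in
/-- A causal encoder for which the channel output up to time `i + T` determines `s[i]` extends to a
streaming code of delay `T` which is feasible for the channel. -/
theorem exists_feasible {F κ ν : Type} [Zero F] {T : ℕ} {chan : Set (Set ℕ)}
    (enc : (ℕ → κ → F) → ℕ → ν → F)
    (hcausal : ∀ (s s' : ℕ → κ → F) (i : ℕ), (∀ j ≤ i, s j = s' j) → enc s i = enc s' i)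
    (hdet : ∀ E ∈ chan, ∀ (s s' : ℕ → κ → F) (i : ℕ),
      (∀ j ≤ i + T, j ∉ E → enc s j = enc s' j) → s i = s' i) :
    ∃ C : StreamingCode F κ ν T, C.encode = enc ∧ C.Feasible chan := by
  -- The decoder picks any source stream consistent with the output up to time i+T, and 0 if there
  -- is none.
  let P : (ℕ → Option (ν → F)) → ℕ → (ℕ → κ → F) → Prop := fun y i s =>
    ∃ E ∈ chan, ∀ j ≤ i + T, y j = received E (enc s) j
  let pick : ((ℕ → κ → F) → Prop) → ℕ → κ → F := fun p i => if h : ∃ s, p s then h.choose i else 0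
  refine ⟨⟨enc, hcausal, fun y i => pick (P y i) i, ?_⟩, rfl, ?_⟩
  · intro y y' i hy
    have : P y i = P y' i := by
      funext s
      refine propext (exists_congr fun E => and_congr_right fun _ => forall₂_congr fun j hj => ?_)
      rw [hy j hj]
    exact congrArg (pick · i) this
  · intro E hE s i
    have h : ∃ s', P (received E (enc s)) i s' := ⟨s, E, hE, fun _ _ => rfl⟩
    change (if h : ∃ s', P (received E (enc s)) i s' then h.choose i else 0) = s i
    rw [dif_pos h]
    obtain ⟨E', hE', hs'⟩ := h.choose_spec
    refine (hdet E hE _ _ i fun j hj hjE => ?_).symm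
    have h1 := hs' j hj
    -- Erasures are visible in the output, so the chosen pattern and the actual one agree up to the
    -- deadline.
    have hjE' : j ∉ E' := fun hj' => hjE <| received_eq_none.1 (h1.trans (received_eq_none.2 hj'))
    simpa [received, hjE, hjE'] using h1

theorem eq_zero_iff_uPart_vPart {μ η F : Type} [Zero F] (s : ℕ → μ ⊕ η → F) (i : ℕ) :
    s i = 0 ↔ uPart s i = 0 ∧ vPart s i = 0 := by
  constructor
  · intro h
    exact ⟨funext fun a => congrFun h (Sum.inl a), funext fun a => congrFun h (Sum.inr a)⟩
  · rintro ⟨h1, h2⟩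
    ext (a | a)
    · exact congrFun h1 a
    · exact congrFun h2 a

/-! ### Erasure correction by the layered code -/

section Midas

variable {F μ η σ : Type} [Field F] [Fintype μ] [Fintype η] {τ : ℕ} {Hv : ℕ → Matrix η μ F}
  {Hu : ℕ → Matrix μ σ F}

theorem midasEncode_sub (s s' : ℕ → μ ⊕ η → F) (i : ℕ) :
    midasEncode τ Hv Hu (s - s') i = midasEncode τ Hv Hu s i - midasEncode τ Hv Hu s' i := by
  have hu : uPart (s - s') = uPart s - uPart s' := rfl
  have hv : vPart (s - s') = vPart s - vPart s' := rfl
  simp only [midasEncode, gmsEncode, hu, hv, parity_sub, delayed_sub]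
  ext ((a | a) | a) <;> simp
  ring

theorem midasEncode_causal (s s' : ℕ → μ ⊕ η → F) (i : ℕ) (h : ∀ j ≤ i, s j = s' j) :
    midasEncode τ Hv Hu s i = midasEncode τ Hv Hu s' i := by
  have hu : ∀ j ≤ i, uPart s j = uPart s' j := fun j hj => funext fun _ => congrFun (h j hj) _
  have hv : ∀ j ≤ i, vPart s j = vPart s' j := fun j hj => funext fun _ => congrFun (h j hj) _
  simp only [midasEncode, gmsEncode, h i le_rfl, parity_congr τ Hv hv, parity_congr τ Hu hu,
    delayed_congr hu]

theorem midasEncode_eq_zero_iff (s : ℕ → μ ⊕ η → F) (i : ℕ) :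
    midasEncode τ Hv Hu s i = 0 ↔ uPart s i = 0 ∧ vPart s i = 0 ∧
      parity τ Hv (vPart s) i + delayed (uPart s) i τ = 0 ∧ parity τ Hu (uPart s) i = 0 := by
  constructor
  · intro h
    refine ⟨?_, ?_, ?_, ?_⟩ <;> ext a
    · exact congrFun h (Sum.inl (Sum.inl (Sum.inl a)))
    · exact congrFun h (Sum.inl (Sum.inl (Sum.inr a)))
    · exact congrFun h (Sum.inl (Sum.inr a))
    · exact congrFun h (Sum.inr a)
  · rintro ⟨h1, h2, h3, h4⟩
    ext (((a | a) | a) | a)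
    · exact congrFun h1 a
    · exact congrFun h2 a
    · exact congrFun h3 a
    · exact congrFun h4 a

/-- The u-code clears u[i] first; this removes the shifted u-symbols from q and leaves a genuine
codeword of the v-code. -/
theorem eq_zero_of_midasEncode_eq_zero_of_card_le [Fintype σ] {N : ℕ} (hHv : IsStronglyMDS τ Hv)
    (hHu : IsStronglyMDS τ Hu)
    (hu : N * (Fintype.card μ + Fintype.card σ) ≤ Fintype.card σ * (τ + 1))
    (hv : N * (Fintype.card η + Fintype.card μ) ≤ Fintype.card μ * (τ + 1))
    {s : ℕ → μ ⊕ η → F} {i : ℕ} (hs : ∀ j < i, s j = 0) (S : Finset ℕ) (hS : S.card ≤ N)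
    (hE : ∀ t ≤ τ, i + t ∉ S → midasEncode τ Hv Hu s (i + t) = 0) : s i = 0 := by
  have hsu : ∀ j < i, uPart s j = 0 := fun j hj => ((eq_zero_iff_uPart_vPart s j).1 (hs j hj)).1
  have hsv : ∀ j < i, vPart s j = 0 := fun j hj => ((eq_zero_iff_uPart_vPart s j).1 (hs j hj)).2
  have hui : uPart s i = 0 := by
    by_contra hne
    have h := hHu.lt_card_mul le_rfl hsu hne S fun t ht htS => by
      obtain ⟨h1, -, -, h4⟩ := (midasEncode_eq_zero_iff s _).1 (hE t ht htS)
      exact systematic_eq_zero h1 h4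
    exact absurd (h.trans_le ((Nat.mul_le_mul_right _ hS).trans hu)) (lt_irrefl _)
  refine (eq_zero_iff_uPart_vPart s i).2 ⟨hui, ?_⟩
  by_contra hne
  have h := hHv.lt_card_mul le_rfl hsv hne S fun t ht htS => by
    obtain ⟨-, h2, h3, -⟩ := (midasEncode_eq_zero_iff s _).1 (hE t ht htS)
    have hd : delayed (uPart s) (i + t) τ = 0 := by
      rw [delayed]
      split_ifs
      · rcases (show i + t - τ ≤ i by omega).eq_or_lt with h | h
        · rw [h, hui]
        · exact hsu _ h
      · rfl
    rw [hd, add_zero] at h3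
    exact systematic_eq_zero h2 h3
  exact absurd (h.trans_le ((Nat.mul_le_mul_right _ hS).trans hv)) (lt_irrefl _)

/-- The v-symbols are cleared one slot at a time, using q before time i+τ only; q[i+τ] then equals
u[i]. The p^u layer plays no role. -/
theorem eq_zero_of_midasEncode_eq_zero_of_burst {B L : ℕ} (hHv : IsStronglyMDS τ Hv)
    (hv : B * (Fintype.card η + Fintype.card μ) ≤ Fintype.card μ * τ) (hBτ : B ≤ τ) (hLB : L ≤ B)
    {s : ℕ → μ ⊕ η → F} {i : ℕ} (hs : ∀ j < i, s j = 0)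
    (hE : ∀ t ≤ τ, L ≤ t → midasEncode τ Hv Hu s (i + t) = 0) : s i = 0 := by
  have hsu : ∀ j < i, uPart s j = 0 := fun j hj => ((eq_zero_iff_uPart_vPart s j).1 (hs j hj)).1
  have hsv : ∀ j < i, vPart s j = 0 := fun j hj => ((eq_zero_iff_uPart_vPart s j).1 (hs j hj)).2
  have hvt : ∀ t ≤ τ, vPart s (i + t) = 0 := by
    intro t
    induction t using Nat.strong_induction_on with
    | _ t ih =>
    intro ht
    by_cases hLt : L ≤ t
    · exact ((midasEncode_eq_zero_iff s _).1 (hE t ht hLt)).2.1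
    by_contra hne
    have hzero : ∀ j < i + t, vPart s j = 0 := by
      intro j hj
      by_cases hji : j < i
      · exact hsv j hji
      · obtain ⟨d, rfl⟩ := Nat.exists_eq_add_of_le (not_lt.1 hji)
        exact ih d (by omega) (by omega)
    -- The horizon stops at slot i+τ-1, since q[i+τ] contains the still unknown u[i].
    have h := hHv.lt_card_mul (j := τ - 1 - t) (by omega) hzero hne (Finset.Ico (i + t) (i + L))
      fun t' ht' ht'S => by
        simp only [Finset.mem_Ico, not_and, not_lt] at ht'S
        have hL := ht'S (by omega)
        rw [add_assoc]
        obtain ⟨-, h2, h3, -⟩ :=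
          (midasEncode_eq_zero_iff s _).1 (hE (t + t') (by omega) (by omega))
        have hd : delayed (uPart s) (i + (t + t')) τ = 0 := by
          rw [delayed]
          split_ifs
          · exact hsu _ (by omega)
          · rfl
        rw [hd, add_zero] at h3
        exact systematic_eq_zero h2 h3
    rw [Nat.card_Ico, show i + L - (i + t) = L - t by omega,
      show τ - 1 - t + 1 = τ - t by omega] at h
    obtain ⟨d, rfl⟩ := Nat.exists_eq_add_of_le (show t ≤ L by omega)
    obtain ⟨e, rfl⟩ := Nat.exists_eq_add_of_le (show t + d ≤ B by omega)
    obtain ⟨f, rfl⟩ := Nat.exists_eq_add_of_le hBτ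
    rw [Nat.add_sub_cancel_left, show t + d + e + f - t = d + e + f by omega] at h
    -- The weight bound reads |μ|(τ-t) < (L-t)(|η|+|μ|), which `hv` and L ≤ B exclude.
    nlinarith [Nat.zero_le (e * Fintype.card η), Nat.zero_le (t * Fintype.card η),
      Nat.zero_le (e * Fintype.card μ)]
  refine (eq_zero_iff_uPart_vPart s i).2 ⟨?_, by simpa using hvt 0 (Nat.zero_le τ)⟩
  obtain ⟨-, -, h3, -⟩ := (midasEncode_eq_zero_iff s _).1 (hE τ le_rfl (hLB.trans hBτ))
  have hp : parity τ Hv (vPart s) (i + τ) = 0 := by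
    refine Finset.sum_eq_zero fun d hd => ?_
    have hd := Finset.mem_range.1 hd
    rw [delayed, if_pos (by omega), show i + τ - d = i + (τ - d) by omega, hvt _ (by omega),
      Matrix.zero_vecMul]
  rwa [hp, zero_add, delayed, if_pos (by omega), Nat.add_sub_cancel] at h3

/-- Over the sliding-window channel, the received packets up to time `i + T` determine `s[i]`. -/
theorem eq_of_midasEncode_eq [Fintype σ] {N B W T : ℕ} (hHv : IsStronglyMDS τ Hv)
    (hHu : IsStronglyMDS τ Hu)
    (hu : N * (Fintype.card μ + Fintype.card σ) ≤ Fintype.card σ * (τ + 1))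
    (hv : B * (Fintype.card η + Fintype.card μ) ≤ Fintype.card μ * τ)
    (hNB : N ≤ B) (hBτ : B ≤ τ) (hτT : τ ≤ T) (hτW : τ < W)
    {E : Set ℕ} (hE : E ∈ channel N B W) (s s' : ℕ → μ ⊕ η → F) (i : ℕ)
    (h : ∀ j ≤ i + T, j ∉ E → midasEncode τ Hv Hu s j = midasEncode τ Hv Hu s' j) :
    s i = s' i := by
  classical
  replace h : ∀ j ≤ i + T, j ∉ E → midasEncode τ Hv Hu (s - s') j = 0 := fun j hj hjE => by
    rw [midasEncode_sub, h j hj hjE, sub_self]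
  suffices H : (s - s') i = 0 from sub_eq_zero.1 H
  generalize s - s' = d at h ⊢
  induction i using Nat.strong_induction_on with
  | _ i ih =>
  have hd : ∀ j < i, d j = 0 := fun j hj => ih j hj fun j' hj' => h j' (by omega)
  by_cases hiE : i ∈ E
  swap
  · obtain ⟨h1, h2, -, -⟩ := (midasEncode_eq_zero_iff d i).1 (h i (by omega) hiE)
    exact (eq_zero_iff_uPart_vPart d i).2 ⟨h1, h2⟩
  have hfin : (E ∩ Set.Ico i (i + W)).Finite := (Set.finite_Ico _ _).inter_of_right _
  rcases hE i with hcard | ⟨a, L, hL, hburst⟩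
  · refine eq_zero_of_midasEncode_eq_zero_of_card_le (N := N) hHv hHu hu ?_ hd hfin.toFinset ?_ ?_
    · calc _ ≤ B * (Fintype.card η + Fintype.card μ) := Nat.mul_le_mul_right _ hNB
        _ ≤ _ := hv
        _ ≤ _ := Nat.mul_le_mul_left _ (Nat.le_succ τ)
    · rwa [← Set.ncard_eq_toFinset_card _ hfin]
    · intro t ht htS
      refine h _ (by omega) fun htE => htS ?_
      rw [Set.Finite.mem_toFinset]
      exact ⟨htE, by simp only [Set.mem_Ico]; omega⟩
  · have hmem : ∀ j, (j ∈ E ∧ i ≤ j ∧ j < i + W) ↔ a ≤ j ∧ j < a + L := fun j => by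
      simpa using Set.ext_iff.1 hburst j
    have hi := (hmem i).1 ⟨hiE, le_rfl, by omega⟩
    have ha := (hmem a).2 ⟨le_rfl, by omega⟩
    -- The burst contains the erased slot i and lies in the window starting at i, so it starts
    -- there.
    obtain rfl : a = i := by omega
    refine eq_zero_of_midasEncode_eq_zero_of_burst (Hu := Hu) hHv hv hBτ hL hd fun t ht hLt => ?_
    refine h _ (by omega) fun htE => ?_
    have := (hmem (a + t)).1 ⟨htE, by omega, by omega⟩
    omega

end Midas

end Streaming

/-! ### Choice of parameters and the rate -/

theorem theorem2 (N B W T : ℕ) (hN : 1 ≤ N) (hNB : N ≤ B) (hBW : B + 1 ≤ W) (hBT : B ≤ T) :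
    ∃ (F : Type) (_ : Field F) (_ : Finite F) (ku kv ks : ℕ)
      (Hv : ℕ → Matrix (Fin kv) (Fin ku) F) (Hu : ℕ → Matrix (Fin ku) (Fin ks) F)
      (C : Streaming.StreamingCode F (Fin ku ⊕ Fin kv)
        (((Fin ku ⊕ Fin kv) ⊕ Fin ku) ⊕ Fin ks) T),
      -- the constituent codes are systematic Strongly-MDS codes of memory `T_eff`
      Streaming.IsStronglyMDS (min T (W - 1)) Hv ∧
      Streaming.IsStronglyMDS (min T (W - 1)) Hu ∧
      -- the code is the layered (MiDAS) code built from them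
      C.encode = Streaming.midasEncode (min T (W - 1)) Hv Hu ∧
      -- every source symbol is decoded with delay `T` over the channel `C(N, B, W)`
      C.Feasible (Streaming.channel N B W) ∧
      -- the rate
      0 < C.rate ∧ C.rate < 1 ∧
      (C.rate / (1 - C.rate)) * (B : ℝ) + (N : ℝ) > ((min T (W - 1) : ℕ) : ℝ) := by
  have hBτ : B ≤ min T (W - 1) := by omega
  have hτT : min T (W - 1) ≤ T := by omega
  have hτW : min T (W - 1) < W := by omega
  generalize min T (W - 1) = τ at *
  obtain ⟨d, rfl⟩ := Nat.exists_eq_add_of_le hNB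
  obtain ⟨e, rfl⟩ := Nat.exists_eq_add_of_le hBτ
  -- With B = N+d and τ = N+d+e these are B(τ-N+1), (τ-B)(τ-N+1) and BN, which make both size
  -- conditions equalities.
  let ku := (N + d) * (d + e + 1)
  let kv := e * (d + e + 1)
  let ks := (N + d) * N
  have hku : 0 < ku := Nat.mul_pos (by omega) (by omega)
  -- A block size that bounds all three lengths lets one field and one x serve both constituent
  -- codes.
  obtain ⟨F, hF, hfin, x, hx⟩ := Streaming.exists_det_toeplitzEntry_ne_zero (ku + kv + ks)
    ((ku + kv + ks) * (N + d + e + 1)) (by omega)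
  have hHv := Streaming.isStronglyMDS_toeplitzParity hx kv ku (by omega) (by omega)
  have hHu := Streaming.isStronglyMDS_toeplitzParity hx ku ks (by omega) (by omega)
  obtain ⟨C, hC, hfeas⟩ := Streaming.exists_feasible (T := T)
    (chan := Streaming.channel N (N + d) W)
    (Streaming.midasEncode (N + d + e) (Streaming.toeplitzParity x (ku + kv + ks) kv ku)
      (Streaming.toeplitzParity x (ku + kv + ks) ku ks))
    Streaming.midasEncode_causal
    (fun E hE => Streaming.eq_of_midasEncode_eq hHv hHu
      (by simp only [Fintype.card_fin, ku, ks]; apply le_of_eq; ring)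
      (by simp only [Fintype.card_fin, ku, kv]; apply le_of_eq; ring) hNB hBτ hτT hτW hE)
  refine ⟨F, hF, hfin, ku, kv, ks, _, _, C, hHv, hHu, hC, hfeas, ?_⟩
  have hrate : C.rate = ((N : ℝ) + d + e) * (d + e + 1) /
      (((N : ℝ) + d + e) * (d + e + 1) + (N + d) * (N + d + e + 1)) := by
    simp only [Streaming.StreamingCode.rate, Fintype.card_sum, Fintype.card_fin, ku, kv, ks]
    push_cast
    congr 1 <;> ring
  have hN' : (1 : ℝ) ≤ N := by exact_mod_cast hN
  have hd' : (0 : ℝ) ≤ d := Nat.cast_nonneg d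
  have he' : (0 : ℝ) ≤ e := Nat.cast_nonneg e
  have hp : 0 < ((N : ℝ) + d + e) * (d + e + 1) := by positivity
  have hq : 0 < ((N : ℝ) + d) * (N + d + e + 1) := by positivity
  have hratio : C.rate / (1 - C.rate)
      = ((N : ℝ) + d + e) * (d + e + 1) / ((N + d) * (N + d + e + 1)) := by
    rw [hrate, one_sub_div (by positivity), add_sub_cancel_left, div_div_div_cancel_right₀]
    positivity
  refine ⟨?_, ?_, ?_⟩
  · rw [hrate]
    positivity
  · rw [hrate, div_lt_one (by positivity)]
    linarith
  -- The excess over τ is exactly N/(τ+1), positive because N ≥ 1.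
  · have hexcess : C.rate / (1 - C.rate) * ((N + d : ℕ) : ℝ) + N
        = ((N + d + e : ℕ) : ℝ) + N / (N + d + e + 1) := by
      rw [hratio]
      push_cast
      field_simp
      ring
    rw [hexcess]
    have : (0 : ℝ) < N / (N + d + e + 1) := by positivity
    linarith
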